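/- Let $\mathbb H$ be the real quaternions with units $i,j,k$. For a real matrix $A=\begin{pmatrix}a&b\\c&d\end{pmatrix}$ with $ad-bc=1$ and $b\neq0$, and for $\mu\in\{i,j\}$, put $$K^{\mu}_{A}(x,\omega)=\frac1{\sqrt{2\pi b}}\,\exp\!\Big(\frac{\mu}{2}\Big(\frac ab x^2-\frac2b x\omega+\frac db\omega^2-\frac\pi2\Big)\Big),\qquad x,\omega\in\mathbb R,$$ where for $b<0$ the root is the principal square root in $\mathbb R+\mu\mathbb R\cong\mathbb C$. For $A_1,A_2$ of this kind, with upper right entries $b_1,b_2$, and for $f,\varphi\in L^2(\mathbb R^2,\mathbb H)$, the Gabor quaternion linear canonical transform is $$\mathcal G^{\varphi}_{A_1,A_2}\{f\}(\omega,y)=\int_{\mathbb R^2}K^{i}_{A_1}(x_1,\omega_1)\,f(x)\,\overline{\varphi(x-y)}\,K^{j}_{A_2}(x_2,\omega_2)\,dx,\qquad \omega,y\in\mathbb R^2.$$ **Theorem (Lieb's inequality).** Let $p,p'$ be real conjugate exponents, $\frac1p+\frac1{p'}=1$, with $2\le p'<\infty$ (equivalently $1<p\le2$). There is a constant $C>0$,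 depending only on $p$, such that for all such $A_1,A_2$ and all $f,\varphi\in L^2(\mathbb R^2,\mathbb H)$ $$\int_{\mathbb R^2}\int_{\mathbb R^2}\big|\mathcal G^{\varphi}_{A_1,A_2}\{f\}(\omega,y)\big|^{p'}\,d\omega\,dy\;\le\;C\,\frac{|b_1b_2|^{-\frac{p'}2+1}}{(2\pi)^{p'}}\,\|f\|_{L^2(\mathbb R^2,\mathbb H)}^{p'}\,\|\varphi\|_{L^2(\mathbb R^2,\mathbb H)}^{p'}.$$ -/

import Mathlib

open MeasureTheory
open scoped Quaternion ENNReal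

noncomputable section

/-- The principal square root of a real number, as a complex number
(so the root of a negative `r` is `i * √|r|`). -/
def principalSqrt (r : ℝ) : ℂ := (r : ℂ) ^ (1 / 2 : ℂ)

/-- The scalar kernel of the linear canonical transform with parameter matrix
`A = (a, b; c, d)`, with values in `ℂ`. -/
def lctKernel (A : Matrix (Fin 2) (Fin 2) ℝ) (x ω : ℝ) : ℂ :=
  if A 0 1 ≠ 0 then
    1 / principalSqrt (2 * Real.pi * A 0 1) *
      Complex.exp (Complex.I / 2 *
        ((A 0 0 / A 0 1 * x ^ 2 - 2 / A 0 1 * x * ω + A 1 1 / A 0 1 * ω ^ 2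
          - Real.pi / 2 : ℝ) : ℂ))
  else
    principalSqrt (A 1 1) *
      Complex.exp (Complex.I * ((A 1 0 * A 1 1 / 2 * ω ^ 2 : ℝ) : ℂ))

/-- The copy of `ℂ` in the quaternions spanned by `1` and `i`. -/
def complexI (z : ℂ) : ℍ[ℝ] := ⟨z.re, z.im, 0, 0⟩

/-- The copy of `ℂ` in the quaternions spanned by `1` and `j`. -/
def complexJ (z : ℂ) : ℍ[ℝ] := ⟨z.re, 0, z.im, 0⟩

/-- The kernel `K^i_A(x, ω)`. -/
def kernelI (A : Matrix (Fin 2) (Fin 2) ℝ) (x ω : ℝ) : ℍ[ℝ] := complexI (lctKernel A x ω)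

/-- The kernel `K^j_A(x, ω)`. -/
def kernelJ (A : Matrix (Fin 2) (Fin 2) ℝ) (x ω : ℝ) : ℍ[ℝ] := complexJ (lctKernel A x ω)

/-- The (two-sided) Gabor quaternion linear canonical transform of `f` with window `φ`. -/
def gqlct (A₁ A₂ : Matrix (Fin 2) (Fin 2) ℝ) (φ f : ℝ × ℝ → ℍ[ℝ]) (ω y : ℝ × ℝ) : ℍ[ℝ] :=
  ∫ x : ℝ × ℝ, kernelI A₁ x.1 ω.1 * f x * star (φ (x - y)) * kernelJ A₂ x.2 ω.2

end

/-! For fixed `y` the transform is a two-sided quaternion linear canonical transform of `F x = f x *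
star (φ (x - y))`. Two bounds carry the proof. Since the kernels have constant modulus,
Cauchy–Schwarz gives a bound `S` uniform in `ω` and `y` (`enorm_qlct_le`,
`lintegral_enorm_mul_star_translate_le`). Plancherel in `ω` (`lintegral_enorm_qlct_sq_le`) and then
Tonelli in `y` bound the total L² mass by `‖f‖² ‖φ‖²`. As `p' ≥ 2`, the integrand is at most `S ^
(p' - 2)` times its square counterpart, and integrating finishes the proof.

The quaternionic Plancherel bound reduces to complex ones: an orthogonal splitting turns right
multiplication by `j` into left multiplication by `∓i`, and each complex kernel is a Fourier kernel
up to unimodular chirps and a constant. -/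

/-! ### Plancherel for integrable functions -/

open FourierTransform SchwartzMap in
/-- The integral Fourier transform of an `L¹ ∩ L²` function represents its `L²` Fourier
transform. -/
theorem fourier_toLp_two_ae_eq {V : Type*} [NormedAddCommGroup V] [InnerProductSpace ℝ V]
    [FiniteDimensional ℝ V] [MeasurableSpace V] [BorelSpace V] {g : V → ℂ}
    (hg : Integrable g) (hg2 : MemLp g 2) :
    (𝓕 (hg2.toLp g) : Lp ℂ 2 (volume : Measure V)) =ᵐ[volume] 𝓕 g := by
  have hcont : Continuous (𝓕 g) :=
    VectorFourier.fourierIntegral_continuous Real.continuous_fourierChar continuous_inner hg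
  -- Test functions are Schwartz, and pairing with them moves either Fourier transform onto the test
  -- function.
  refine ae_eq_of_integral_contDiff_smul_eq ((Lp.memLp _).locallyIntegrable (by norm_num))
    hcont.locallyIntegrable fun η hη hη' => ?_
  have hd : ContDiff ℝ (⊤ : ℕ∞) (fun x => (η x : ℂ)) := Complex.ofRealCLM.contDiff.comp hη
  have hs : HasCompactSupport (fun x => (η x : ℂ)) := hη'.comp_left Complex.ofReal_zero
  let S : 𝓢(V, ℂ) := hs.toSchwartzMap hd
  have h1 := congrArg (fun T => T S) (Lp.fourier_toTemperedDistribution_eq (hg2.toLp g))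
  simp only [TemperedDistribution.fourier_apply, Lp.toTemperedDistribution_apply] at h1
  have h2 : ∫ ξ, (𝓕 g ξ) • S ξ = ∫ x, g x • (𝓕 (S : V → ℂ) x) := by
    have := VectorFourier.integral_fourierIntegral_smul_eq_flip (μ := volume) (ν := volume)
      (L := innerₗ V) Real.continuous_fourierChar (by exact continuous_inner) hg S.integrable
    rw [flip_innerₗ] at this
    exact this
  have h3 : ∫ x, (𝓕 S) x • (hg2.toLp g : V → ℂ) x = ∫ x, g x • (𝓕 (S : V → ℂ) x) := by
    refine integral_congr_ae ?_
    filter_upwards [hg2.coeFn_toLp] with x hx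
    rw [hx, fourier_coe, smul_eq_mul, smul_eq_mul, mul_comm]
  calc ∫ x, η x • (𝓕 (hg2.toLp g) : Lp ℂ 2 (volume : Measure V)) x
      = ∫ x, S x • (𝓕 (hg2.toLp g) : Lp ℂ 2 (volume : Measure V)) x := rfl
    _ = ∫ ξ, (𝓕 g ξ) • S ξ := by rw [← h1, h3, h2]
    _ = ∫ x, η x • 𝓕 g x := by
      refine integral_congr_ae (.of_forall fun x => ?_)
      change 𝓕 g x * (η x : ℂ) = η x • 𝓕 g x
      rw [Complex.real_smul, mul_comm]

open FourierTransform in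
/-- Plancherel's inequality for integrable functions. -/
theorem lintegral_enorm_fourier_sq_le {V : Type*} [NormedAddCommGroup V] [InnerProductSpace ℝ V]
    [FiniteDimensional ℝ V] [MeasurableSpace V] [BorelSpace V] {g : V → ℂ}
    (hg : Integrable g) :
    ∫⁻ ξ, ‖𝓕 g ξ‖ₑ ^ (2 : ℝ) ≤ ∫⁻ x, ‖g x‖ₑ ^ (2 : ℝ) := by
  by_cases h2 : MemLp g 2
  · have h : eLpNorm (𝓕 g) 2 volume = eLpNorm g 2 volume := by
      rw [← eLpNorm_congr_ae (fourier_toLp_two_ae_eq hg h2), ← Lp.enorm_def, ← Lp.enorm_toLp h2,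
        ← ofReal_norm, Lp.norm_fourier_eq, ofReal_norm]
    rw [eLpNorm_eq_lintegral_rpow_enorm_toReal (by norm_num) (by norm_num),
      eLpNorm_eq_lintegral_rpow_enorm_toReal (by norm_num) (by norm_num)] at h
    exact (ENNReal.rpow_left_injective (by norm_num) h).le
  · have : ∫⁻ x, ‖g x‖ₑ ^ (2 : ℝ) = ⊤ := by
      by_contra h
      exact h2 ⟨hg.1, by
        rw [eLpNorm_lt_top_iff_lintegral_rpow_enorm_lt_top (by norm_num) (by norm_num)]
        exact Ne.lt_top h⟩
    rw [this]
    exact le_top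

/-- Change of variables for a coordinatewise dilation of the plane. -/
theorem lintegral_comp_prod_mul_left {F : ℝ × ℝ → ℝ≥0∞} (hF : Measurable F) {s t : ℝ}
    (hs : s ≠ 0) (ht : t ≠ 0) :
    ∫⁻ ω : ℝ × ℝ, F (s * ω.1, t * ω.2) = ENNReal.ofReal |s * t|⁻¹ * ∫⁻ ω, F ω := by
  have hm : Measurable (Prod.map (s * ·) (t * ·) : ℝ × ℝ → ℝ × ℝ) := by fun_prop
  rw [show (fun ω : ℝ × ℝ => F (s * ω.1, t * ω.2)) = fun ω => F (Prod.map (s * ·) (t * ·) ω)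
    from rfl, ← lintegral_map hF hm, Measure.volume_eq_prod,
    ← Measure.map_prod_map _ _ (by fun_prop) (by fun_prop), Real.map_volume_mul_left hs,
    Real.map_volume_mul_left ht, Measure.prod_smul_left, Measure.prod_smul_right, smul_smul,
    lintegral_smul_measure, smul_eq_mul, ← ENNReal.ofReal_mul (abs_nonneg _), ← abs_mul,
    ← mul_inv, abs_inv]

open FourierTransform in
/-- Plancherel's inequality on the plane, with rescaled frequencies. -/
theorem lintegral_enorm_oscillatory_sq_le {u : ℝ × ℝ → ℂ} (hu : Integrable u) {s t : ℝ}
    (hs : s ≠ 0) (ht : t ≠ 0) :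
    ∫⁻ ω : ℝ × ℝ, ‖∫ x : ℝ × ℝ,
        Complex.exp (((-(s * x.1 * ω.1 + t * x.2 * ω.2) : ℝ) : ℂ) * Complex.I) * u x‖ₑ ^ (2 : ℝ) ≤
      ENNReal.ofReal ((2 * Real.pi) ^ 2 * |s * t|⁻¹) * ∫⁻ x, ‖u x‖ₑ ^ (2 : ℝ) := by
  have hpi : 2 * Real.pi ≠ 0 := by positivity
  -- `ℝ × ℝ` carries the sup norm; the Fourier transform needs the Euclidean copy, which has the
  -- same volume.
  have mp := WithLp.volume_preserving_toLp ℝ ℝ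
  have me : MeasurableEmbedding (WithLp.toLp 2 : ℝ × ℝ → WithLp 2 (ℝ × ℝ)) :=
    (MeasurableEquiv.toLp 2 (ℝ × ℝ)).measurableEmbedding
  let g : WithLp 2 (ℝ × ℝ) → ℂ := fun v => u v.ofLp
  have hg : Integrable g := (mp.integrable_comp_emb me).1 hu
  have hcont : Continuous (𝓕 g) :=
    VectorFourier.fourierIntegral_continuous Real.continuous_fourierChar continuous_inner hg
  let F : ℝ × ℝ → ℝ≥0∞ := fun ξ => ‖𝓕 g (WithLp.toLp 2 ξ)‖ₑ ^ (2 : ℝ)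
  have hF : Measurable F := (hcont.measurable.comp mp.measurable).enorm.pow_const _
  have key (ω : ℝ × ℝ) : ‖∫ x : ℝ × ℝ,
      Complex.exp (((-(s * x.1 * ω.1 + t * x.2 * ω.2) : ℝ) : ℂ) * Complex.I) * u x‖ₑ ^ (2 : ℝ) =
      F (s / (2 * Real.pi) * ω.1, t / (2 * Real.pi) * ω.2) := by
    simp only [F]
    rw [Real.fourier_eq', ← mp.integral_comp me]
    congr 4 with x
    simp only [WithLp.prod_inner_apply, g, smul_eq_mul]
    congr 3
    norm_cast
    simp
    field_simp
    ring
  simp_rw [key]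
  rw [lintegral_comp_prod_mul_left hF (div_ne_zero hs hpi) (div_ne_zero ht hpi)]
  have h1 : ∫⁻ ξ, F ξ = ∫⁻ v, ‖𝓕 g v‖ₑ ^ (2 : ℝ) :=
    mp.lintegral_comp_emb me fun v => ‖𝓕 g v‖ₑ ^ (2 : ℝ)
  have h2 : ∫⁻ x, ‖u x‖ₑ ^ (2 : ℝ) = ∫⁻ v, ‖g v‖ₑ ^ (2 : ℝ) :=
    mp.lintegral_comp_emb me fun v => ‖g v‖ₑ ^ (2 : ℝ)
  rw [h1, h2]
  refine (mul_le_mul_right (lintegral_enorm_fourier_sq_le hg) _).trans (le_of_eq ?_)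
  congr 2
  rw [div_mul_div_comm, abs_div, inv_div, abs_of_pos (by positivity : 0 < 2 * Real.pi * _)]
  ring

/-! ### Canonical transform kernels as chirped Fourier kernels -/

theorem norm_principalSqrt {r : ℝ} (hr : r ≠ 0) : ‖principalSqrt r‖ = √|r| := by
  rw [principalSqrt, Complex.norm_cpow_of_ne_zero (by exact_mod_cast hr)]
  simp [Real.sqrt_eq_rpow]

/-- The canonical transform kernel with `b ≠ 0` is a Fourier kernel up to chirps. -/
theorem exists_lctKernel_eq {A : Matrix (Fin 2) (Fin 2) ℝ} (hb : A 0 1 ≠ 0) :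
    ∃ α β : ℝ → ℂ, Continuous α ∧ (∀ x, ‖α x‖ = 1) ∧
      (∀ ω, ‖β ω‖ = (√(2 * Real.pi * |A 0 1|))⁻¹) ∧
      ∀ x ω, lctKernel A x ω =
        β ω * α x * Complex.exp (((-((A 0 1)⁻¹ * x * ω) : ℝ) : ℂ) * Complex.I) := by
  refine ⟨fun x => Complex.exp ((A 0 0 / A 0 1 * x ^ 2 / 2 : ℝ) * Complex.I),
    fun ω => 1 / principalSqrt (2 * Real.pi * A 0 1) *
      Complex.exp ((A 1 1 / A 0 1 * ω ^ 2 / 2 - Real.pi / 4 : ℝ) * Complex.I),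
    by fun_prop, fun x => Complex.norm_exp_ofReal_mul_I _, fun ω => ?_, fun x ω => ?_⟩
  · rw [norm_mul, Complex.norm_exp_ofReal_mul_I, norm_div, norm_one, norm_principalSqrt
      (by positivity), abs_mul, abs_of_pos (by positivity : 0 < 2 * Real.pi), mul_one, one_div]
  · rw [lctKernel, if_pos hb]
    beta_reduce
    rw [mul_assoc (1 / _), mul_assoc (1 / _), ← Complex.exp_add, ← Complex.exp_add]
    congr 2
    have : (A 0 1 : ℂ) ≠ 0 := by exact_mod_cast hb
    push_cast
    field_simp
    ring

theorem norm_lctKernel {A : Matrix (Fin 2) (Fin 2) ℝ} (hb : A 0 1 ≠ 0) (x ω : ℝ) :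
    ‖lctKernel A x ω‖ = (√(2 * Real.pi * |A 0 1|))⁻¹ := by
  obtain ⟨α, β, -, hα, hβ, h⟩ := exists_lctKernel_eq hb
  rw [h, norm_mul, norm_mul, hα, hβ, Complex.norm_exp_ofReal_mul_I, mul_one, mul_one]

theorem Continuous.lctKernel {X : Type*} [TopologicalSpace X] {A : Matrix (Fin 2) (Fin 2) ℝ}
    (hb : A 0 1 ≠ 0) {f g : X → ℝ} (hf : Continuous f) (hg : Continuous g) :
    Continuous fun x => lctKernel A (f x) (g x) := by
  simp only [_root_.lctKernel, if_pos hb]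
  fun_prop

/-- Plancherel's inequality for kernels that are Fourier kernels up to chirps. -/
theorem lintegral_enorm_chirp_sq_le {k₁ k₂ : ℝ → ℝ → ℂ} {α₁ β₁ α₂ β₂ : ℝ → ℂ} {s t : ℝ}
    (hs : s ≠ 0) (ht : t ≠ 0) (hα₁ : Continuous α₁) (hα₂ : Continuous α₂)
    (hn₁ : ∀ x, ‖α₁ x‖ = 1) (hn₂ : ∀ x, ‖α₂ x‖ = 1)
    (hβ₁ : ∀ ω, ‖β₁ ω‖ = (√(2 * Real.pi * |s|⁻¹))⁻¹)
    (hβ₂ : ∀ ω, ‖β₂ ω‖ = (√(2 * Real.pi * |t|⁻¹))⁻¹)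
    (h₁ : ∀ x ω, k₁ x ω = β₁ ω * α₁ x * Complex.exp (((-(s * x * ω) : ℝ) : ℂ) * Complex.I))
    (h₂ : ∀ x ω, k₂ x ω = β₂ ω * α₂ x * Complex.exp (((-(t * x * ω) : ℝ) : ℂ) * Complex.I))
    {u : ℝ × ℝ → ℂ} (hu : Integrable u) :
    ∫⁻ ω : ℝ × ℝ, ‖∫ x : ℝ × ℝ, k₁ x.1 ω.1 * k₂ x.2 ω.2 * u x‖ₑ ^ (2 : ℝ) ≤
      ∫⁻ x, ‖u x‖ₑ ^ (2 : ℝ) := by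
  let v : ℝ × ℝ → ℂ := fun x => α₁ x.1 * α₂ x.2 * u x
  have hvn (x) : ‖v x‖ = ‖u x‖ := by simp [v, hn₁, hn₂]
  have hv : Integrable v := by
    refine hu.mono ?_ (.of_forall fun x => (hvn x).le)
    exact (Continuous.aestronglyMeasurable (by fun_prop)).mul hu.1
  -- `‖β₁‖² ‖β₂‖²` is exactly the reciprocal of the constant in the oscillatory estimate, so the
  -- final constant is 1.
  have key (ω : ℝ × ℝ) : ‖∫ x : ℝ × ℝ, k₁ x.1 ω.1 * k₂ x.2 ω.2 * u x‖ₑ ^ (2 : ℝ) =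
      ENNReal.ofReal (((2 * Real.pi) ^ 2 * |s * t|⁻¹)⁻¹) * ‖∫ x : ℝ × ℝ,
        Complex.exp (((-(s * x.1 * ω.1 + t * x.2 * ω.2) : ℝ) : ℂ) * Complex.I) * v x‖ₑ ^
          (2 : ℝ) := by
    have : ∀ x : ℝ × ℝ, k₁ x.1 ω.1 * k₂ x.2 ω.2 * u x = β₁ ω.1 * β₂ ω.2 *
        (Complex.exp (((-(s * x.1 * ω.1 + t * x.2 * ω.2) : ℝ) : ℂ) * Complex.I) * v x) := by
      intro x
      rw [h₁, h₂, neg_add, Complex.ofReal_add, add_mul, Complex.exp_add]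
      simp only [v]
      ring
    simp_rw [this]
    rw [integral_const_mul, enorm_mul, ENNReal.mul_rpow_of_nonneg _ _ (by norm_num)]
    congr 1
    rw [← ofReal_norm, norm_mul, hβ₁, hβ₂,
      ENNReal.ofReal_rpow_of_nonneg (by positivity) (by norm_num)]
    congr 1
    rw [Real.rpow_two, ← mul_inv, inv_pow, mul_pow, Real.sq_sqrt (by positivity),
      Real.sq_sqrt (by positivity), abs_mul, mul_inv]
    ring
  simp_rw [key]
  rw [lintegral_const_mul' _ _ ENNReal.ofReal_ne_top]
  refine (mul_le_mul_right (lintegral_enorm_oscillatory_sq_le hv hs ht) _).trans (le_of_eq ?_)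
  have hpos : 0 < (2 * Real.pi) ^ 2 * |s * t|⁻¹ :=
    mul_pos (by positivity) (inv_pos.2 (abs_pos.2 (mul_ne_zero hs ht)))
  rw [← mul_assoc, ← ENNReal.ofReal_mul (by positivity), inv_mul_cancel₀ hpos.ne',
    ENNReal.ofReal_one, one_mul]
  refine lintegral_congr fun x => ?_
  rw [← ofReal_norm, hvn, ofReal_norm]

theorem lintegral_enorm_lct_sq_le {A B : Matrix (Fin 2) (Fin 2) ℝ} (hA : A 0 1 ≠ 0)
    (hB : B 0 1 ≠ 0) {u : ℝ × ℝ → ℂ} (hu : Integrable u) :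
    ∫⁻ ω : ℝ × ℝ, ‖∫ x : ℝ × ℝ,
        lctKernel A x.1 ω.1 * lctKernel B x.2 ω.2 * u x‖ₑ ^ (2 : ℝ) ≤
      ∫⁻ x, ‖u x‖ₑ ^ (2 : ℝ) := by
  obtain ⟨α₁, β₁, hc₁, hα₁, hβ₁, h₁⟩ := exists_lctKernel_eq hA
  obtain ⟨α₂, β₂, hc₂, hα₂, hβ₂, h₂⟩ := exists_lctKernel_eq hB
  exact lintegral_enorm_chirp_sq_le (inv_ne_zero hA) (inv_ne_zero hB) hc₁ hc₂ hα₁ hα₂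
    (by simpa [abs_inv] using hβ₁) (by simpa [abs_inv] using hβ₂) h₁ h₂ hu

/-- Conjugating the second kernel conjugates its chirps and reverses its frequency, so the same
estimate applies with `t = -(B 0 1)⁻¹`. The `+` part of the splitting needs this case. -/
theorem lintegral_enorm_lct_conj_sq_le {A B : Matrix (Fin 2) (Fin 2) ℝ} (hA : A 0 1 ≠ 0)
    (hB : B 0 1 ≠ 0) {u : ℝ × ℝ → ℂ} (hu : Integrable u) :
    ∫⁻ ω : ℝ × ℝ, ‖∫ x : ℝ × ℝ,
        lctKernel A x.1 ω.1 * star (lctKernel B x.2 ω.2) * u x‖ₑ ^ (2 : ℝ) ≤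
      ∫⁻ x, ‖u x‖ₑ ^ (2 : ℝ) := by
  obtain ⟨α₁, β₁, hc₁, hα₁, hβ₁, h₁⟩ := exists_lctKernel_eq hA
  obtain ⟨α₂, β₂, hc₂, hα₂, hβ₂, h₂⟩ := exists_lctKernel_eq hB
  refine lintegral_enorm_chirp_sq_le (k₂ := fun x ω => star (lctKernel B x ω))
    (α₂ := fun x => star (α₂ x)) (β₂ := fun x => star (β₂ x)) (inv_ne_zero hA)
    (neg_ne_zero.2 (inv_ne_zero hB)) hc₁ hc₂.star hα₁ (by simpa using hα₂)
    (by simpa [abs_inv] using hβ₁) (by simpa [abs_inv] using hβ₂) h₁ (fun x ω => ?_) hu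
  rw [h₂, star_mul', star_mul']
  congr 1
  rw [Complex.star_def, ← Complex.exp_conj, map_mul, Complex.conj_I, Complex.conj_ofReal]
  congr 1
  push_cast
  ring

/-! ### The two-sided splitting of the quaternions -/

@[simp] theorem re_complexI (z : ℂ) : (complexI z).re = z.re := rfl
@[simp] theorem imI_complexI (z : ℂ) : (complexI z).imI = z.im := rfl
@[simp] theorem imJ_complexI (z : ℂ) : (complexI z).imJ = 0 := rfl
@[simp] theorem imK_complexI (z : ℂ) : (complexI z).imK = 0 := rfl
@[simp] theorem re_complexJ (z : ℂ) : (complexJ z).re = z.re := rfl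
@[simp] theorem imI_complexJ (z : ℂ) : (complexJ z).imI = 0 := rfl
@[simp] theorem imJ_complexJ (z : ℂ) : (complexJ z).imJ = z.im := rfl
@[simp] theorem imK_complexJ (z : ℂ) : (complexJ z).imK = 0 := rfl

/-- The coordinate of a quaternion in the `+` part of the two-sided splitting
`q = (q + i q j) / 2 + (q - i q j) / 2`. -/
noncomputable def splitPos : ℍ[ℝ] →L[ℝ] ℂ :=
  LinearMap.toContinuousLinearMap
    { toFun := fun q => ⟨(q.re + q.imK) / 2, (q.imI - q.imJ) / 2⟩
      map_add' := fun p q => by apply Complex.ext <;> simp <;> ring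
      map_smul' := fun r q => by apply Complex.ext <;> simp <;> ring }

/-- The coordinate of a quaternion in the `-` part of the two-sided splitting
`q = (q + i q j) / 2 + (q - i q j) / 2`. -/
noncomputable def splitNeg : ℍ[ℝ] →L[ℝ] ℂ :=
  LinearMap.toContinuousLinearMap
    { toFun := fun q => ⟨(q.re - q.imK) / 2, (q.imI + q.imJ) / 2⟩
      map_add' := fun p q => by apply Complex.ext <;> simp <;> ring
      map_smul' := fun r q => by apply Complex.ext <;> simp <;> ring }

theorem splitPos_apply (q : ℍ[ℝ]) :
    splitPos q = ⟨(q.re + q.imK) / 2, (q.imI - q.imJ) / 2⟩ := rfl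

theorem splitNeg_apply (q : ℍ[ℝ]) :
    splitNeg q = ⟨(q.re - q.imK) / 2, (q.imI + q.imJ) / 2⟩ := rfl

/-- The `+` part satisfies `i q j = q`, hence `q j = -i q`: a right factor in `j` passes to the left
as its conjugate in `i`. On the `-` part `q j = i q`, without conjugation. -/
theorem splitPos_mul (z w : ℂ) (q : ℍ[ℝ]) :
    splitPos (complexI z * q * complexJ w) = z * star w * splitPos q := by
  apply Complex.ext <;> simp [splitPos_apply] <;> ring

theorem splitNeg_mul (z w : ℂ) (q : ℍ[ℝ]) :
    splitNeg (complexI z * q * complexJ w) = z * w * splitNeg q := by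
  apply Complex.ext <;> simp [splitNeg_apply] <;> ring

/-- The two parts are `splitPos q` times `1 + k` and `splitNeg q` times `1 - k`; they are
orthogonal, and `|1 ± k|² = 2`. -/
theorem enorm_sq_eq_split (q : ℍ[ℝ]) :
    ‖q‖ₑ ^ (2 : ℝ) = 2 * ‖splitPos q‖ₑ ^ (2 : ℝ) + 2 * ‖splitNeg q‖ₑ ^ (2 : ℝ) := by
  have h : ‖q‖ ^ 2 = 2 * ‖splitPos q‖ ^ 2 + 2 * ‖splitNeg q‖ ^ 2 := by
    rw [sq, ← Quaternion.normSq_eq_norm_mul_self, Quaternion.normSq_def', Complex.sq_norm,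
      Complex.sq_norm, Complex.normSq_apply, Complex.normSq_apply]
    simp only [splitPos_apply, splitNeg_apply]
    ring
  simp only [ENNReal.rpow_two, ← ofReal_norm]
  rw [← ENNReal.ofReal_pow (norm_nonneg _), ← ENNReal.ofReal_pow (norm_nonneg _),
    ← ENNReal.ofReal_pow (norm_nonneg _), h, ENNReal.ofReal_add (by positivity) (by positivity),
    ENNReal.ofReal_mul (by norm_num), ENNReal.ofReal_mul (by norm_num), ENNReal.ofReal_ofNat]

theorem norm_complexI (z : ℂ) : ‖complexI z‖ = ‖z‖ := by
  rw [← sq_eq_sq₀ (norm_nonneg _) (norm_nonneg _), sq, ← Quaternion.normSq_eq_norm_mul_self,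
    Quaternion.normSq_def', Complex.sq_norm, Complex.normSq_apply]
  simp [sq]

theorem norm_complexJ (z : ℂ) : ‖complexJ z‖ = ‖z‖ := by
  rw [← sq_eq_sq₀ (norm_nonneg _) (norm_nonneg _), sq, ← Quaternion.normSq_eq_norm_mul_self,
    Quaternion.normSq_def', Complex.sq_norm, Complex.normSq_apply]
  simp [sq]

theorem continuous_complexI : Continuous complexI :=
  (AddMonoidHomClass.isometry_of_norm
    ({ toFun := complexI
       map_zero' := by ext <;> simp
       map_add' := fun z w => by ext <;> simp } : ℂ →+ ℍ[ℝ]) norm_complexI).continuous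

theorem continuous_complexJ : Continuous complexJ :=
  (AddMonoidHomClass.isometry_of_norm
    ({ toFun := complexJ
       map_zero' := by ext <;> simp
       map_add' := fun z w => by ext <;> simp } : ℂ →+ ℍ[ℝ]) norm_complexJ).continuous

/-! ### L² and L^∞ bounds for the quaternion transform -/

/-- The two-sided quaternion linear canonical transform integrand is integrable. -/
theorem Integrable.kernel_mul {A₁ A₂ : Matrix (Fin 2) (Fin 2) ℝ} (h₁ : A₁ 0 1 ≠ 0)
    (h₂ : A₂ 0 1 ≠ 0) {F : ℝ × ℝ → ℍ[ℝ]} (hF : Integrable F) (ω : ℝ × ℝ) :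
    Integrable fun x : ℝ × ℝ => kernelI A₁ x.1 ω.1 * F x * kernelJ A₂ x.2 ω.2 := by
  have c₁ : Continuous fun x : ℝ × ℝ => kernelI A₁ x.1 ω.1 :=
    continuous_complexI.comp (Continuous.lctKernel h₁ (by fun_prop) continuous_const)
  have c₂ : Continuous fun x : ℝ × ℝ => kernelJ A₂ x.2 ω.2 :=
    continuous_complexJ.comp (Continuous.lctKernel h₂ (by fun_prop) continuous_const)
  refine ((hF.norm.const_mul (√(2 * Real.pi * |A₁ 0 1|))⁻¹).mul_const
    (√(2 * Real.pi * |A₂ 0 1|))⁻¹).mono'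
    ((c₁.aestronglyMeasurable.mul hF.1).mul c₂.aestronglyMeasurable) (.of_forall fun x => ?_)
  rw [norm_mul, norm_mul, kernelI, kernelJ, norm_complexI, norm_complexJ, norm_lctKernel h₁,
    norm_lctKernel h₂]

/-- Plancherel's inequality for the two-sided quaternion linear canonical transform. -/
theorem lintegral_enorm_qlct_sq_le {A₁ A₂ : Matrix (Fin 2) (Fin 2) ℝ} (h₁ : A₁ 0 1 ≠ 0)
    (h₂ : A₂ 0 1 ≠ 0) {F : ℝ × ℝ → ℍ[ℝ]} (hF : Integrable F) :
    ∫⁻ ω : ℝ × ℝ, ‖∫ x : ℝ × ℝ, kernelI A₁ x.1 ω.1 * F x * kernelJ A₂ x.2 ω.2‖ₑ ^ (2 : ℝ) ≤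
      ∫⁻ x, ‖F x‖ₑ ^ (2 : ℝ) := by
  have hP := splitPos.integrable_comp hF
  have hN := splitNeg.integrable_comp hF
  have key (ω : ℝ × ℝ) :
      ‖∫ x : ℝ × ℝ, kernelI A₁ x.1 ω.1 * F x * kernelJ A₂ x.2 ω.2‖ₑ ^ (2 : ℝ) =
      2 * ‖∫ x : ℝ × ℝ, lctKernel A₁ x.1 ω.1 * star (lctKernel A₂ x.2 ω.2) *
          splitPos (F x)‖ₑ ^ (2 : ℝ) +
        2 * ‖∫ x : ℝ × ℝ, lctKernel A₁ x.1 ω.1 * lctKernel A₂ x.2 ω.2 *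
          splitNeg (F x)‖ₑ ^ (2 : ℝ) := by
    have hi := Integrable.kernel_mul h₁ h₂ hF ω
    rw [enorm_sq_eq_split, ← splitPos.integral_comp_comm hi, ← splitNeg.integral_comp_comm hi]
    simp only [kernelI, kernelJ, splitPos_mul, splitNeg_mul]
  have hm : AEMeasurable fun x => 2 * ‖splitPos (F x)‖ₑ ^ (2 : ℝ) :=
    (hP.1.enorm.pow_const _).const_mul _
  -- Splitting the integral of a sum needs one measurable summand; joint measurability in `(ω, x)`
  -- supplies it.
  have hm' : AEMeasurable fun ω : ℝ × ℝ => 2 * ‖∫ x : ℝ × ℝ, lctKernel A₁ x.1 ω.1 *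
      star (lctKernel A₂ x.2 ω.2) * splitPos (F x)‖ₑ ^ (2 : ℝ) := by
    have c₁ : Continuous fun z : (ℝ × ℝ) × (ℝ × ℝ) => lctKernel A₁ z.2.1 z.1.1 :=
      Continuous.lctKernel h₁ (by fun_prop) (by fun_prop)
    have c₂ : Continuous fun z : (ℝ × ℝ) × (ℝ × ℝ) => star (lctKernel A₂ z.2.2 z.1.2) :=
      (Continuous.lctKernel h₂ (by fun_prop) (by fun_prop)).star
    have h : AEStronglyMeasurable (fun z : (ℝ × ℝ) × (ℝ × ℝ) => lctKernel A₁ z.2.1 z.1.1 *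
        star (lctKernel A₂ z.2.2 z.1.2) * splitPos (F z.2)) (volume.prod volume) :=
      (c₁.mul c₂).aestronglyMeasurable.mul hP.1.comp_snd
    exact (h.integral_prod_right'.enorm.pow_const _).const_mul _
  simp_rw [key, enorm_sq_eq_split (F _)]
  rw [lintegral_add_left' hm', lintegral_add_left' hm, lintegral_const_mul' _ _ (by norm_num),
    lintegral_const_mul' _ _ (by norm_num), lintegral_const_mul' _ _ (by norm_num),
    lintegral_const_mul' _ _ (by norm_num)]
  exact add_le_add (mul_le_mul_right (lintegral_enorm_lct_conj_sq_le h₁ h₂ hP) _)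
    (mul_le_mul_right (lintegral_enorm_lct_sq_le h₁ h₂ hN) _)

/-- The two-sided quaternion linear canonical transform maps `L¹` to `L^∞`. -/
theorem enorm_qlct_le {A₁ A₂ : Matrix (Fin 2) (Fin 2) ℝ} (h₁ : A₁ 0 1 ≠ 0) (h₂ : A₂ 0 1 ≠ 0)
    (F : ℝ × ℝ → ℍ[ℝ]) (ω : ℝ × ℝ) :
    ‖∫ x : ℝ × ℝ, kernelI A₁ x.1 ω.1 * F x * kernelJ A₂ x.2 ω.2‖ₑ ≤
      ENNReal.ofReal ((2 * Real.pi * √|A₁ 0 1 * A₂ 0 1|)⁻¹) * ∫⁻ x, ‖F x‖ₑ := by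
  refine (enorm_integral_le_lintegral_enorm _).trans (le_of_eq ?_)
  rw [← lintegral_const_mul' _ _ ENNReal.ofReal_ne_top]
  have hr (b : ℝ) : √(2 * Real.pi * |b|) = √(2 * Real.pi) * √|b| := Real.sqrt_mul (by positivity) _
  have hc : (2 * Real.pi * √|A₁ 0 1 * A₂ 0 1|)⁻¹ =
      (√(2 * Real.pi * |A₁ 0 1|))⁻¹ * (√(2 * Real.pi * |A₂ 0 1|))⁻¹ := by
    rw [hr, hr, ← mul_inv, mul_mul_mul_comm, Real.mul_self_sqrt (by positivity), abs_mul,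
      Real.sqrt_mul (abs_nonneg _)]
  refine lintegral_congr fun x => ?_
  rw [← ofReal_norm, ← ofReal_norm, ← ENNReal.ofReal_mul (by positivity), norm_mul, norm_mul,
    kernelI, kernelJ, norm_complexI, norm_complexJ, norm_lctKernel h₁, norm_lctKernel h₂, hc,
    mul_right_comm]

/-! ### The windowed signal -/

theorem MemLp.translate {φ : ℝ × ℝ → ℍ[ℝ]} (hφ : MemLp φ 2) (y : ℝ × ℝ) :
    MemLp (fun x => φ (x - y)) 2 :=
  hφ.comp_measurePreserving (measurePreserving_sub_right volume y)

theorem integrable_mul_star_translate {f φ : ℝ × ℝ → ℍ[ℝ]} (hf : MemLp f 2) (hφ : MemLp φ 2)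
    (y : ℝ × ℝ) : Integrable fun x => f x * star (φ (x - y)) := by
  have hφ' := MemLp.translate hφ y
  refine (hf.norm.integrable_mul hφ'.norm).mono'
    (hf.1.mul (continuous_star.comp_aestronglyMeasurable hφ'.1)) (.of_forall fun x => ?_)
  simp

theorem lintegral_enorm_mul_star_translate_le {f φ : ℝ × ℝ → ℍ[ℝ]} (hf : MemLp f 2)
    (hφ : MemLp φ 2) (y : ℝ × ℝ) :
    ∫⁻ x, ‖f x * star (φ (x - y))‖ₑ ≤ eLpNorm f 2 volume * eLpNorm φ 2 volume := by
  have hφ' := MemLp.translate hφ y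
  have h := ENNReal.lintegral_mul_le_Lp_mul_Lq volume Real.HolderConjugate.two_two
    hf.1.enorm hφ'.1.enorm
  rw [← eLpNorm_comp_measurePreserving hφ.1 (measurePreserving_sub_right volume y),
    eLpNorm_eq_lintegral_rpow_enorm_toReal (by norm_num) (by norm_num),
    eLpNorm_eq_lintegral_rpow_enorm_toReal (by norm_num) (by norm_num)]
  simpa [Function.comp_def, ← ofReal_norm, ENNReal.ofReal_mul] using h

/-- The quaternion norm is multiplicative, so Tonelli and translation invariance factor the double
integral. -/
theorem lintegral_lintegral_mul_star_translate {f φ : ℝ × ℝ → ℍ[ℝ]} (hf : MemLp f 2)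
    (hφ : MemLp φ 2) :
    ∫⁻ y : ℝ × ℝ, ∫⁻ x, ‖f x * star (φ (x - y))‖ₑ ^ (2 : ℝ) =
      eLpNorm f 2 volume ^ (2 : ℝ) * eLpNorm φ 2 volume ^ (2 : ℝ) := by
  have he (x y : ℝ × ℝ) : ‖f x * star (φ (x - y))‖ₑ ^ (2 : ℝ) =
      ‖f x‖ₑ ^ (2 : ℝ) * ‖φ (x - y)‖ₑ ^ (2 : ℝ) := by
    rw [← ENNReal.mul_rpow_of_nonneg _ _ (by norm_num), ← ofReal_norm, norm_mul, norm_star,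
      ENNReal.ofReal_mul (norm_nonneg _), ofReal_norm, ofReal_norm]
  have hn (g : ℝ × ℝ → ℍ[ℝ]) : eLpNorm g 2 volume ^ (2 : ℝ) = ∫⁻ x, ‖g x‖ₑ ^ (2 : ℝ) := by
    rw [eLpNorm_eq_lintegral_rpow_enorm_toReal (by norm_num) (by norm_num), ← ENNReal.rpow_mul]
    norm_num
  simp_rw [he]
  rw [lintegral_lintegral_swap, hn, hn]
  · rw [← lintegral_mul_const'' _ (hf.1.enorm.pow_const _)]
    refine lintegral_congr fun x => ?_
    rw [lintegral_const_mul' _ _ (by simp), lintegral_sub_left_eq_self (fun z => ‖φ z‖ₑ ^ (2 : ℝ)) x]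
  · have h1 : AEStronglyMeasurable (fun z : (ℝ × ℝ) × (ℝ × ℝ) => f z.2) (volume.prod volume) :=
      hf.1.comp_snd
    have h2 : AEStronglyMeasurable (fun z : (ℝ × ℝ) × (ℝ × ℝ) => φ (z.2 - z.1))
        (volume.prod volume) :=
      hφ.1.comp_quasiMeasurePreserving ((quasiMeasurePreserving_sub volume volume).comp
        Measure.measurePreserving_swap.quasiMeasurePreserving)
    exact (h1.enorm.pow_const _).mul (h2.enorm.pow_const _)

/-! ### Lieb's inequality -/

theorem gqlct_eq (A₁ A₂ : Matrix (Fin 2) (Fin 2) ℝ) (φ f : ℝ × ℝ → ℍ[ℝ]) (ω y : ℝ × ℝ) :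
    gqlct A₁ A₂ φ f ω y =
      ∫ x : ℝ × ℝ, kernelI A₁ x.1 ω.1 * (f x * star (φ (x - y))) * kernelJ A₂ x.2 ω.2 := by
  simp only [gqlct, mul_assoc]

theorem mainTheorem4 (p p' : ℝ) (hpp' : p.HolderConjugate p') (hp' : 2 ≤ p') :
    ∃ C : ℝ, 0 < C ∧
      ∀ A₁ A₂ : Matrix (Fin 2) (Fin 2) ℝ, A₁.det = 1 → A₂.det = 1 →
        A₁ 0 1 ≠ 0 → A₂ 0 1 ≠ 0 →
        ∀ f φ : ℝ × ℝ → ℍ[ℝ], MemLp f 2 volume → MemLp φ 2 volume →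
          ∫⁻ y : ℝ × ℝ, ∫⁻ ω : ℝ × ℝ, ‖gqlct A₁ A₂ φ f ω y‖ₑ ^ p' ≤
            ENNReal.ofReal
                (C * (|A₁ 0 1 * A₂ 0 1| ^ (-p' / 2 + 1) / (2 * Real.pi) ^ p')) *
              eLpNorm f 2 volume ^ p' * eLpNorm φ 2 volume ^ p' := by
  -- The sup bound contributes `(2π) ^ (2 - p')`, while the claim displays `(2π) ^ (-p')`; the
  -- constant is the quotient.
  refine ⟨(2 * Real.pi) ^ (2 : ℝ), by positivity, fun A₁ A₂ _ _ h₁ h₂ f φ hf hφ => ?_⟩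
  have hp2 : 0 ≤ p' - 2 := by linarith
  set c : ℝ := (2 * Real.pi * √|A₁ 0 1 * A₂ 0 1|)⁻¹ with hc
  set S : ℝ≥0∞ := ENNReal.ofReal c * (eLpNorm f 2 volume * eLpNorm φ 2 volume) with hS
  have hS_top : S ^ (p' - 2) ≠ ∞ := ENNReal.rpow_ne_top_of_nonneg hp2
    (ENNReal.mul_ne_top ENNReal.ofReal_ne_top (ENNReal.mul_ne_top hf.2.ne hφ.2.ne))
  have hpow (a : ℝ≥0∞) : a ^ p' = a ^ (p' - 2) * a ^ (2 : ℝ) := by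
    rw [← ENNReal.rpow_add_of_nonneg _ _ hp2 (by norm_num), sub_add_cancel]
  have hsup (ω y : ℝ × ℝ) : ‖gqlct A₁ A₂ φ f ω y‖ₑ ≤ S := by
    rw [gqlct_eq]
    exact (enorm_qlct_le h₁ h₂ _ ω).trans
      (mul_le_mul_right (lintegral_enorm_mul_star_translate_le hf hφ y) _)
  have hL2 (y : ℝ × ℝ) : ∫⁻ ω : ℝ × ℝ, ‖gqlct A₁ A₂ φ f ω y‖ₑ ^ (2 : ℝ) ≤
      ∫⁻ x, ‖f x * star (φ (x - y))‖ₑ ^ (2 : ℝ) := by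
    simp_rw [gqlct_eq]
    exact lintegral_enorm_qlct_sq_le h₁ h₂ (integrable_mul_star_translate hf hφ y)
  have hcpow : c ^ (p' - 2) = (2 * Real.pi) ^ (2 : ℝ) *
      (|A₁ 0 1 * A₂ 0 1| ^ (-p' / 2 + 1) / (2 * Real.pi) ^ p') := by
    rw [hc, Real.inv_rpow (by positivity), ← Real.rpow_neg (by positivity),
      Real.mul_rpow (by positivity) (by positivity), Real.sqrt_eq_rpow,
      ← Real.rpow_mul (abs_nonneg _), show -(p' - 2) = 2 - p' by ring,
      Real.rpow_sub (by positivity), show 1 / 2 * (2 - p') = -p' / 2 + 1 by ring]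
    ring
  calc ∫⁻ y : ℝ × ℝ, ∫⁻ ω : ℝ × ℝ, ‖gqlct A₁ A₂ φ f ω y‖ₑ ^ p'
      ≤ ∫⁻ y : ℝ × ℝ, ∫⁻ ω : ℝ × ℝ, S ^ (p' - 2) * ‖gqlct A₁ A₂ φ f ω y‖ₑ ^ (2 : ℝ) := by
        refine lintegral_mono fun y => lintegral_mono fun ω => ?_
        simp only [hpow]
        exact mul_le_mul_left (ENNReal.rpow_le_rpow (hsup ω y) hp2) _
    _ = S ^ (p' - 2) * ∫⁻ y : ℝ × ℝ, ∫⁻ ω : ℝ × ℝ, ‖gqlct A₁ A₂ φ f ω y‖ₑ ^ (2 : ℝ) := by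
        simp_rw [lintegral_const_mul' _ _ hS_top]
    _ ≤ S ^ (p' - 2) * (eLpNorm f 2 volume ^ (2 : ℝ) * eLpNorm φ 2 volume ^ (2 : ℝ)) := by
        rw [← lintegral_lintegral_mul_star_translate hf hφ]
        exact mul_le_mul_right (lintegral_mono hL2) _
    _ = _ := by
        rw [← hcpow, ← ENNReal.ofReal_rpow_of_nonneg (by positivity) hp2,
          hpow (eLpNorm f 2 volume), hpow (eLpNorm φ 2 volume), hS,
          ENNReal.mul_rpow_of_nonneg _ _ hp2, ENNReal.mul_rpow_of_nonneg _ _ hp2]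
        ring
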